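/- Call a real polynomial $Q(x)=a_nx^n+\dots+a_1x+a_0$ of degree $n$ *semi-non-degenerating* (SND) if $\max_{0\le j\le n}|a_{n-j}|=1$ and this maximum is attained for some $j\le n/2$. Let $d\ge 2$ and $N\ge 2$ be integers and let $\delta<1$ be real. There is a constant $C_{d,N,\delta}>0$, depending only on $d$, $N$ and $\delta$, such that the following holds. Let $f$ be a smooth real-valued function on a compact interval $I=[a,b]$ such that either $f^{(N)}\ge 0$ on all of $I$ or $f^{(N)}\le 0$ on all of $I$. Suppose that for some $A\ge 1$ and all non-zero real $\lambda$, $$\left|\int_I e^{i\lambda f(x)}\,dx\right|\le A|\lambda|^{-\delta}.$$ Then for every real polynomial $P$ of degree $d$ such that $P'$ is monic, and all non-zero real $\lambda$, $$\left|\int_I e^{i\lambda P(f(x))}\,dx\right|\le C_{d,N,\delta}\,A^{1/(1-\delta)}|\lambda|^{-\delta/d}.$$ The same estimate holds for every real polynomial $P$ of degree $d$ such that $P'$ is SND and all real $\lambda$ with $|\lambda|\ge 1$. -/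

import Mathlib

open Set MeasureTheory Polynomial
open scoped ContDiff

/-- A real-valued function is single-signed on a set if it is nonnegative throughout the set
or nonpositive throughout the set. -/
def SingleSignedOn (g : ℝ → ℝ) (s : Set ℝ) : Prop :=
  (∀ x ∈ s, 0 ≤ g x) ∨ (∀ x ∈ s, g x ≤ 0)

/-- A real polynomial `Q = a_n x^n + ⋯ + a_0` of degree `n` is semi-non-degenerating (SND) if
`max_j |a_{n-j}| = 1` and the maximum is attained at some `j ≤ n / 2`. -/
def IsSND (Q : ℝ[X]) : Prop :=
  (∀ k, |Q.coeff k| ≤ 1) ∧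
    ∃ j : ℕ, 2 * j ≤ Q.natDegree ∧ |Q.coeff (Q.natDegree - j)| = 1

/-- The oscillatory integral `∫_s e^{i t φ(x)} dx` with phase `φ` and parameter `t`. -/
noncomputable def oscInt (φ : ℝ → ℝ) (s : Set ℝ) (t : ℝ) : ℂ :=
  ∫ x in s, Complex.exp (Complex.I * (t : ℂ) * (φ x : ℂ))

/-! Write Q = P', n = d - 1 and ε = |λ|^(-1/d). The interval is cut into a number of pieces bounded
in terms of d and N, on each of which f'', f' ± μ, Q(f) ± η and Q'(f) have constant sign, where μ =
ε^(1-δ) and η = (cε)^n. Such a partition exists because f^(N) is single-signed: each integration at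
most doubles the number of pieces, so f and its lower derivatives cross any level boundedly often.

On a piece of length L there are three cases. If |f'| ≤ μ, then f varies by at most μL. If |Q(f)| ≤
η, then f varies by at most nε, since Q exceeds η somewhere on every interval of that length
(`exists_pos_lt_abs_eval_on_Icc`). In both cases the decay hypothesis, averaged against a Gaussian,
bounds L (`exists_length_le_of_oscInt_decay`) and the integral is at most L. Otherwise the phase
derivative Q(f)f' is a product of two monotone factors bounded away from zero, and integration by
parts gives 6/(|λ|ημ) (`norm_integral_exp_le_of_deriv_eq_mul`). The choice of μ and η makes all
three bounds multiples of ε^δ = |λ|^(-δ/d). -/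

/-- `SignPartition F m a b` says that `[a, b]` splits into at most `m` consecutive intervals, in the
interior of each of which every function of the family `F` is single-signed. -/
inductive SignPartition (F : Set (ℝ → ℝ)) : ℕ → ℝ → ℝ → Prop
  | single {n : ℕ} {a b : ℝ} (hab : a ≤ b) (h : ∀ g ∈ F, SingleSignedOn g (Ioo a b)) :
      SignPartition F (n + 1) a b
  | split {m n : ℕ} {a s b : ℝ} (hl : SignPartition F m a s) (hr : SignPartition F n s b) :
      SignPartition F (m + n) a b

/-! ### Calculus of sign partitions -/

theorem SingleSignedOn.mono {g : ℝ → ℝ} {s t : Set ℝ} (h : SingleSignedOn g t) (hst : s ⊆ t) :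
    SingleSignedOn g s :=
  h.imp (fun h x hx => h x (hst hx)) (fun h x hx => h x (hst hx))

theorem SingleSignedOn.of_neg {g : ℝ → ℝ} {s : Set ℝ} (h : SingleSignedOn (fun x => -g x) s) :
    SingleSignedOn g s := by
  rcases h with h | h
  · exact Or.inr fun x hx => by have := h x hx; linarith
  · exact Or.inl fun x hx => by have := h x hx; linarith

namespace SignPartition

variable {F G : Set (ℝ → ℝ)} {m n k : ℕ} {a b : ℝ}

theorem le (h : SignPartition F m a b) : a ≤ b := by
  induction h with
  | single hab _ => exact hab
  | split _ _ ih₁ ih₂ => exact ih₁.trans ih₂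

theorem mono_card (h : SignPartition F m a b) : ∀ {n : ℕ}, m ≤ n → SignPartition F n a b := by
  induction h with
  | single hab h =>
    intro n hn
    obtain ⟨k, rfl⟩ : ∃ k, n = k + 1 := ⟨n - 1, by omega⟩
    exact single hab h
  | @split m k a s b hl hr ih₁ ih₂ =>
    intro n hn
    obtain ⟨l, rfl⟩ : ∃ l, n = m + l := ⟨n - m, by omega⟩
    exact split hl (ih₂ (by omega))

theorem bind (h : SignPartition F m a b)
    (H : ∀ u v, a ≤ u → u ≤ v → v ≤ b → (∀ g ∈ F, SingleSignedOn g (Ioo u v)) →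
      SignPartition G k u v) : SignPartition G (m * k) a b := by
  induction h with
  | @single n a b hab h =>
    exact (H a b le_rfl hab le_rfl h).mono_card (Nat.le_mul_of_pos_left k n.succ_pos)
  | @split m n a s b hl hr ih₁ ih₂ =>
    rw [add_mul]
    exact split (ih₁ fun u v hu huv hv => H u v hu huv (hv.trans hr.le))
      (ih₂ fun u v hu huv hv => H u v (hl.le.trans hu) huv hv)

theorem union_of_forall (h : SignPartition G m a b)
    (hF : ∀ g ∈ F, SingleSignedOn g (Ioo a b)) : SignPartition (F ∪ G) m a b := by
  induction h with
  | single hab h =>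
    refine single hab fun g hg => ?_
    rcases hg with hg | hg
    exacts [hF g hg, h g hg]
  | split hl hr ih₁ ih₂ =>
    exact split (ih₁ fun g hg => (hF g hg).mono (Ioo_subset_Ioo_right hr.le))
      (ih₂ fun g hg => (hF g hg).mono (Ioo_subset_Ioo_left hl.le))

theorem union (h : SignPartition F m a b)
    (H : ∀ u v, a ≤ u → u ≤ v → v ≤ b → SignPartition G k u v) :
    SignPartition (F ∪ G) (m * k) a b :=
  h.bind fun u v hu huv hv hF => (H u v hu huv hv).union_of_forall hF

theorem norm_integral_le (h : SignPartition F m a b) {φ : ℝ → ℂ} {B : ℝ}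
    (hφ : ContinuousOn φ (Icc a b))
    (H : ∀ u v, a ≤ u → u ≤ v → v ≤ b → (∀ g ∈ F, SingleSignedOn g (Ioo u v)) →
      ‖∫ x in u..v, φ x‖ ≤ B) : ‖∫ x in a..b, φ x‖ ≤ m * B := by
  induction h with
  | @single n a b hab h =>
    have h1 := H a b le_rfl hab le_rfl h
    have h2 : 0 ≤ B := (norm_nonneg _).trans h1
    push_cast
    nlinarith [mul_nonneg (Nat.cast_nonneg (α := ℝ) n) h2]
  | @split m n a s b hl hr ih₁ ih₂ =>
    have c1 : ContinuousOn φ (Icc a s) := hφ.mono (Icc_subset_Icc_right hr.le)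
    have c2 : ContinuousOn φ (Icc s b) := hφ.mono (Icc_subset_Icc_left hl.le)
    rw [← intervalIntegral.integral_add_adjacent_intervals
      (c1.intervalIntegrable_of_Icc hl.le) (c2.intervalIntegrable_of_Icc hr.le)]
    have h1 := ih₁ c1 fun u v hu huv hv => H u v hu huv (hv.trans hr.le)
    have h2 := ih₂ c2 fun u v hu huv hv => H u v (hl.le.trans hu) huv hv
    push_cast
    linarith [norm_add_le (∫ x in a..s, φ x) (∫ x in s..b, φ x)]

theorem of_monotoneOn {g : ℝ → ℝ} (hab : a ≤ b) (hg : ContinuousOn g (Icc a b))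
    (hm : MonotoneOn g (Icc a b)) (c : ℝ) : SignPartition {fun x => g x - c} 2 a b := by
  have ha : a ∈ Icc a b := ⟨le_rfl, hab⟩
  have hb : b ∈ Icc a b := ⟨hab, le_rfl⟩
  by_cases h1 : g b ≤ c
  · refine single hab ?_
    rintro _ rfl
    refine Or.inr fun x hx => ?_
    have := hm (Ioo_subset_Icc_self hx) hb hx.2.le
    simp only; linarith
  by_cases h2 : c ≤ g a
  · refine single hab ?_
    rintro _ rfl
    refine Or.inl fun x hx => ?_
    have := hm ha (Ioo_subset_Icc_self hx) hx.1.le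
    simp only; linarith
  obtain ⟨s, hs, rfl⟩ := intermediate_value_Icc hab hg ⟨(not_le.1 h2).le, (not_le.1 h1).le⟩
  refine split (m := 1) (n := 1) (s := s) (single (n := 0) hs.1 ?_) (single (n := 0) hs.2 ?_)
  · rintro _ rfl
    refine Or.inr fun x hx => ?_
    have := hm ⟨hx.1.le, hx.2.le.trans hs.2⟩ hs hx.2.le
    simp only; linarith
  · rintro _ rfl
    refine Or.inl fun x hx => ?_
    have := hm hs ⟨hs.1.trans hx.1.le, hx.2.le⟩ hx.1.le
    simp only; linarith

theorem neg_singleton {g : ℝ → ℝ} (h : SignPartition {fun x => -g x} m a b) :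
    SignPartition {g} m a b := by
  have := h.bind (G := {g}) (k := 1) fun _ _ _ huv _ H => by
    refine single huv ?_
    rintro _ rfl
    exact SingleSignedOn.of_neg (H _ rfl)
  simpa using this

/-- A function with single-signed derivative is monotone, so it crosses the level c at most once. -/
theorem of_hasDerivAt {g g' : ℝ → ℝ} (hab : a ≤ b) (hg : ContinuousOn g (Icc a b))
    (hd : ∀ x ∈ Ioo a b, HasDerivAt g (g' x) x) (hs : SingleSignedOn g' (Ioo a b)) (c : ℝ) :
    SignPartition {fun x => g x - c} 2 a b := by
  rcases hs with hs | hs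
  · refine of_monotoneOn hab hg (monotoneOn_of_deriv_nonneg (convex_Icc a b) hg ?_ ?_) c
    · rw [interior_Icc]
      exact fun x hx => (hd x hx).differentiableAt.differentiableWithinAt
    · rw [interior_Icc]
      exact fun x hx => by rw [(hd x hx).deriv]; exact hs x hx
  · refine neg_singleton ?_
    have : SignPartition {fun x => -g x - -c} 2 a b := by
      refine of_monotoneOn hab hg.neg (monotoneOn_of_deriv_nonneg (convex_Icc a b) hg.neg ?_ ?_) (-c)
      · rw [interior_Icc]
        exact fun x hx => (hd x hx).neg.differentiableAt.differentiableWithinAt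
      · rw [interior_Icc]
        intro x hx
        rw [(hd x hx).neg.deriv]
        have := hs x hx
        linarith
    convert this using 3
    ring

theorem antideriv {g g' : ℝ → ℝ} (hg : ContinuousOn g (Icc a b))
    (hd : ∀ x ∈ Ioo a b, HasDerivAt g (g' x) x) (h : SignPartition {g'} m a b) (c : ℝ) :
    SignPartition {fun x => g x - c} (m * 2) a b :=
  h.bind fun _ _ hu huv hv H => of_hasDerivAt huv (hg.mono (Icc_subset_Icc hu hv))
    (fun x hx => hd x (Ioo_subset_Ioo hu hv hx)) (H _ rfl) c

theorem sub_finset {f : ℝ → ℝ} (hab : a ≤ b)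
    (H : ∀ c u v, a ≤ u → u ≤ v → v ≤ b → SignPartition {fun x => f x - c} k u v)
    (T : Finset ℝ) : SignPartition {g | ∃ r ∈ T, g = fun x => f x - r} (k ^ T.card) a b := by
  classical
  induction T using Finset.induction_on with
  | empty => exact single (n := 0) hab (by simp)
  | insert r T hr ih =>
    have := ih.union (H r)
    rw [Finset.card_insert_of_notMem hr, pow_succ]
    convert this using 1
    ext g
    simp only [Finset.mem_insert, mem_ofPred_eq, mem_union, mem_singleton_iff]
    constructor
    · rintro ⟨s, rfl | hs, rfl⟩
      · exact Or.inr rfl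
      · exact Or.inl ⟨s, hs, rfl⟩
    · rintro (⟨s, hs, rfl⟩ | rfl)
      · exact ⟨s, Or.inr hs, rfl⟩
      · exact ⟨r, Or.inl rfl, rfl⟩

end SignPartition

/-- A sign change of R(f) between x and y forces a root r of R strictly between f(x) and f(y), so f
- r changes sign too. No continuity of f is needed. -/
theorem singleSignedOn_eval_comp {f : ℝ → ℝ} {s : Set ℝ} (R : ℝ[X])
    (h : ∀ r ∈ R.roots.toFinset, SingleSignedOn (fun x => f x - r) s) :
    SingleSignedOn (fun x => R.eval (f x)) s := by
  by_contra hcon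
  unfold SingleSignedOn at hcon
  push Not at hcon
  obtain ⟨⟨x, hx, hx0⟩, y, hy, hy0⟩ := hcon
  have hR : R ≠ 0 := by rintro rfl; simp at hx0
  have hc : ContinuousOn (fun z => R.eval z) (uIcc (f x) (f y)) := R.continuous.continuousOn
  obtain ⟨r, hr, hr0⟩ := intermediate_value_uIcc hc
    (show (0 : ℝ) ∈ uIcc (R.eval (f x)) (R.eval (f y)) from mem_uIcc.2 (Or.inl ⟨hx0.le, hy0.le⟩))
  have hrx : r ≠ f x := by rintro rfl; simp only at hr0; linarith
  have hry : r ≠ f y := by rintro rfl; simp only at hr0; linarith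
  have hmem : r ∈ R.roots.toFinset := by simp [hR]; exact hr0
  rcases h r hmem with H | H
  · have h1 := H x hx
    have h2 := H y hy
    rcases mem_uIcc.1 hr with ⟨h3, h4⟩ | ⟨h3, h4⟩
    · exact hrx (le_antisymm (by linarith) h3)
    · exact hry (le_antisymm (by linarith) h3)
  · have h1 := H x hx
    have h2 := H y hy
    rcases mem_uIcc.1 hr with ⟨h3, h4⟩ | ⟨h3, h4⟩
    · exact hry (le_antisymm h4 (by linarith))
    · exact hrx (le_antisymm h4 (by linarith))

theorem SignPartition.eval_comp {f : ℝ → ℝ} {a b : ℝ} {k n : ℕ} (hab : a ≤ b) (hk : 1 ≤ k)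
    (H : ∀ c u v, a ≤ u → u ≤ v → v ≤ b → SignPartition {fun x => f x - c} k u v)
    (R : ℝ[X]) (hR : R.natDegree ≤ n) :
    SignPartition {fun x => R.eval (f x)} (k ^ n) a b := by
  have h1 := (SignPartition.sub_finset hab H R.roots.toFinset).bind (G := {fun x => R.eval (f x)})
    (k := 1) fun u v _ huv _ hF => by
      refine single huv ?_
      rintro _ rfl
      exact singleSignedOn_eval_comp R fun r hr => hF _ ⟨r, hr, rfl⟩
  refine h1.mono_card ?_
  rw [mul_one]
  exact Nat.pow_le_pow_right hk
    ((Multiset.toFinset_card_le _).trans ((card_roots' R).trans hR))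

/-! ### Lower bounds for monic and SND polynomials -/

/-- Lagrange interpolation at the nodes 0, …, n writes each coefficient as a fixed linear
combination of the values. -/
theorem exists_abs_coeff_le_of_abs_eval_natCast_le (n : ℕ) :
    ∃ K : ℝ, 0 < K ∧ ∀ R : ℝ[X], R.natDegree ≤ n → ∀ η : ℝ,
      (∀ l : ℕ, l ≤ n → |R.eval (l : ℝ)| ≤ η) → ∀ i, |R.coeff i| ≤ K * η := by
  let s := Finset.range (n + 1)
  let v : ℕ → ℝ := fun l => (l : ℝ)
  let B : ℕ → ℕ → ℝ := fun l i => |(Lagrange.basis s v l).coeff i|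
  have hB : ∀ l i, 0 ≤ B l i := fun l i => abs_nonneg _
  refine ⟨1 + ∑ l ∈ s, ∑ i ∈ s, B l i, ?_, ?_⟩
  · have : 0 ≤ ∑ l ∈ s, ∑ i ∈ s, B l i :=
      Finset.sum_nonneg fun l _ => Finset.sum_nonneg fun i _ => hB l i
    linarith
  intro R hR η hη i
  have hη0 : 0 ≤ η := (abs_nonneg _).trans (hη 0 (Nat.zero_le _))
  by_cases hi : n < i
  · rw [coeff_eq_zero_of_natDegree_lt (hR.trans_lt hi), abs_zero]
    have : 0 ≤ ∑ l ∈ s, ∑ i ∈ s, B l i :=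
      Finset.sum_nonneg fun l _ => Finset.sum_nonneg fun i _ => hB l i
    positivity
  have his : i ∈ s := by simp only [s, Finset.mem_range]; omega
  have hinj : Set.InjOn v s := fun x _ y _ h => Nat.cast_injective (R := ℝ) h
  have hdeg : R.degree < s.card := by
    refine degree_le_natDegree.trans_lt ?_
    simp only [s, Finset.card_range]
    exact_mod_cast Nat.lt_succ_of_le hR
  have hinterp := Lagrange.eq_interpolate hinj hdeg
  have hco : R.coeff i = ∑ l ∈ s, R.eval (v l) * (Lagrange.basis s v l).coeff i := by
    conv_lhs => rw [hinterp]
    simp [Lagrange.interpolate_apply]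
  rw [hco]
  calc |∑ l ∈ s, R.eval (v l) * (Lagrange.basis s v l).coeff i|
      ≤ ∑ l ∈ s, |R.eval (v l) * (Lagrange.basis s v l).coeff i| := Finset.abs_sum_le_sum_abs _ _
    _ ≤ ∑ l ∈ s, η * ∑ i ∈ s, B l i := by
        refine Finset.sum_le_sum fun l hl => ?_
        rw [abs_mul]
        refine mul_le_mul (hη l ?_) ?_ (abs_nonneg _) hη0
        · simp only [s, Finset.mem_range] at hl; omega
        · exact Finset.single_le_sum (f := B l) (fun i _ => hB l i) his
    _ ≤ (1 + ∑ l ∈ s, ∑ i ∈ s, B l i) * η := by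
        rw [← Finset.mul_sum]; linarith

/-- Expand 1 = (-X + (1 + X))^m, multiply by (1 + X)^(n-m), and compare coefficients of X^j. -/
theorem sum_neg_one_pow_mul_choose_mul_choose {n m : ℕ} (hm : m ≤ n) (j : ℕ) :
    ∑ i ∈ Finset.range (j + 1), (-1 : ℝ) ^ i * (n - i).choose (j - i) * m.choose i
      = (n - m).choose j := by
  have h1 : ∑ i ∈ Finset.range (m + 1), (-X : ℝ[X]) ^ i * (1 + X) ^ (m - i) * (m.choose i : ℝ[X])
      = 1 := by
    rw [← add_pow]; simp
  have h2 : ∑ i ∈ Finset.range (m + 1), (C ((-1) ^ i * (m.choose i : ℝ)) * X ^ i) *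
      (1 + X : ℝ[X]) ^ (n - i) = (1 + X) ^ (n - m) := by
    calc _ = (1 + X) ^ (n - m) * ∑ i ∈ Finset.range (m + 1),
          (-X : ℝ[X]) ^ i * (1 + X) ^ (m - i) * (m.choose i : ℝ[X]) := by
            rw [Finset.mul_sum]
            refine Finset.sum_congr rfl fun i hi => ?_
            have : n - i = (n - m) + (m - i) := by
              have := Finset.mem_range.1 hi; omega
            rw [this, pow_add, neg_pow (X : ℝ[X]) i]
            simp only [map_mul, map_pow, map_neg, map_one, map_natCast]
            ring
      _ = _ := by rw [h1, mul_one]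
  have h3 := congrArg (fun p => p.coeff j) h2
  simp only [finsetSum_coeff, coeff_one_add_X_pow] at h3
  rw [← h3]
  have h4 : ∀ i, ((C ((-1) ^ i * (m.choose i : ℝ)) * X ^ i) * (1 + X : ℝ[X]) ^ (n - i)).coeff j
      = if i ≤ j then (-1 : ℝ) ^ i * (n - i).choose (j - i) * m.choose i else 0 := by
    intro i
    rw [mul_assoc, coeff_C_mul, coeff_X_pow_mul']
    split_ifs
    · rw [coeff_one_add_X_pow]; ring
    · simp
  simp only [h4]
  rw [← Finset.sum_filter]
  symm
  rw [Finset.sum_subset (s₁ := (Finset.range (m + 1)).filter (· ≤ j)) (s₂ := Finset.range (j + 1))]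
  · intro i hi
    simp only [Finset.mem_filter, Finset.mem_range] at hi ⊢; omega
  · intro i hi hi'
    simp only [Finset.mem_filter, Finset.mem_range] at hi hi'
    rw [Nat.choose_eq_zero_of_lt (n := m) (k := i) (by omega)]
    simp

theorem taylor_coeff_eq_sum {Q : ℝ[X]} {n : ℕ} (hn : Q.natDegree ≤ n) (p : ℝ) (i : ℕ) :
    (taylor p Q).coeff i
      = ∑ m ∈ Finset.range (n + 1), Q.coeff m * m.choose i * p ^ (m - i) := by
  rw [taylor_coeff, hasseDeriv_apply, Polynomial.sum_over_range' Q _ (n + 1) (by omega),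
    eval_finsetSum]
  · refine Finset.sum_congr rfl fun m _ => ?_
    rw [eval_monomial]; ring
  · intro m; simp

/-- Both sides are the coefficient of h^j in the degree-n homogenization of Q at (p, 1 + h),
computed from the expansions of Q about 0 and about p. The left side sees only the coefficients of Q
with m ≤ n - j. -/
theorem sum_coeff_mul_choose_mul_pow {Q : ℝ[X]} {n : ℕ} (hn : Q.natDegree ≤ n) (p : ℝ) (j : ℕ) :
    ∑ m ∈ Finset.range (n + 1), Q.coeff m * (n - m).choose j * p ^ m
      = ∑ i ∈ Finset.range (j + 1),
          (-1 : ℝ) ^ i * (n - i).choose (j - i) * p ^ i * (taylor p Q).coeff i := by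
  simp only [taylor_coeff_eq_sum hn]
  simp_rw [Finset.mul_sum]
  rw [Finset.sum_comm]
  refine Finset.sum_congr rfl fun m hm => ?_
  rw [← sum_neg_one_pow_mul_choose_mul_choose (Nat.lt_succ_iff.1 (Finset.mem_range.1 hm)) j,
    Finset.mul_sum, Finset.sum_mul]
  refine Finset.sum_congr rfl fun i _ => ?_
  by_cases him : i ≤ m
  · conv_lhs => rw [show m = i + (m - i) by omega, pow_add]
    rw [show i + (m - i) = m by omega]
    ring
  · rw [Nat.choose_eq_zero_of_lt (n := m) (k := i) (by omega)]
    simp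

theorem choose_le_two_pow_real {n m : ℕ} (hm : m ≤ n) (j : ℕ) : ((m.choose j : ℕ) : ℝ) ≤ 2 ^ n := by
  have := (Nat.choose_le_two_pow m j).trans (Nat.pow_le_pow_right (by norm_num) hm)
  exact_mod_cast this

/-- The Taylor coefficients of a semi-non-degenerating polynomial cannot all be small at a point. -/
theorem exists_pos_lt_abs_taylor_coeff_of_isSND (n : ℕ) (hn : 1 ≤ n) :
    ∃ τ : ℝ, 0 < τ ∧ ∀ Q : ℝ[X], Q.natDegree = n → IsSND Q → ∀ p : ℝ,
      ∃ i ≤ n, τ < |(taylor p Q).coeff i| := by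
  -- Beyond this radius, half of |p|^(n-j) exceeds the bound 2^n n |p|^(n-j-1) for the lower-order
  -- terms.
  set R₀ : ℝ := 2 ^ (n + 1) * n + 1 with hR₀
  have hR₀1 : 1 ≤ R₀ := by rw [hR₀]; linarith [show (0:ℝ) ≤ 2 ^ (n + 1) * n by positivity]
  refine ⟨((n + 1) * 2 ^ (n + 1) * R₀ ^ n)⁻¹, by positivity, ?_⟩
  set τ : ℝ := ((n + 1) * 2 ^ (n + 1) * R₀ ^ n)⁻¹ with hτ
  have hτ0 : 0 < τ := by positivity
  have hτ1 : τ * ((n + 1) * 2 ^ n * R₀ ^ n) = 1 / 2 := by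
    rw [hτ, pow_succ]; field_simp
  have hτ2 : τ * ((n + 1) * 2 ^ n) ≤ 1 / 2 := by
    rw [← hτ1]
    refine mul_le_mul_of_nonneg_left ?_ hτ0.le
    exact le_mul_of_one_le_right (by positivity) (one_le_pow₀ hR₀1)
  rintro Q hQ ⟨hle, j, hj, hone⟩ p
  rw [hQ] at hj hone
  by_contra! hcon
  have hq : ∀ i, |(taylor p Q).coeff i| ≤ τ := by
    intro i
    by_cases hi : i ≤ n
    · exact hcon i hi
    · rw [coeff_eq_zero_of_natDegree_lt (by rw [natDegree_taylor]; omega), abs_zero]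
      exact hτ0.le
  -- For p near the origin, re-expanding from p back to 0 would make every coefficient of Q at most
  -- 1/2. For distant p that loses powers of p, and the homogenized identity is used instead.
  by_cases hp : |p| ≤ R₀
  · have h1 : Q.coeff (n - j) = ∑ m ∈ Finset.range (n + 1),
        (taylor p Q).coeff m * m.choose (n - j) * (-p) ^ (m - (n - j)) := by
      rw [← taylor_coeff_eq_sum (by rw [natDegree_taylor]; exact hQ.le), taylor_taylor]
      simp
    have h2 : |Q.coeff (n - j)| ≤ 1 / 2 := by
      rw [h1]
      calc _ ≤ ∑ m ∈ Finset.range (n + 1),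
            |(taylor p Q).coeff m * m.choose (n - j) * (-p) ^ (m - (n - j))| :=
              Finset.abs_sum_le_sum_abs _ _
        _ ≤ ∑ m ∈ Finset.range (n + 1), τ * 2 ^ n * R₀ ^ n := by
            refine Finset.sum_le_sum fun m hm => ?_
            have hm' : m ≤ n := Nat.lt_succ_iff.1 (Finset.mem_range.1 hm)
            rw [abs_mul, abs_mul, abs_pow, abs_neg, Nat.abs_cast]
            refine mul_le_mul (mul_le_mul (hq m) (choose_le_two_pow_real hm' _)
              (Nat.cast_nonneg _) hτ0.le) ?_ (by positivity) (by positivity)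
            exact (pow_le_pow_left₀ (abs_nonneg _) hp _).trans
              (pow_le_pow_right₀ hR₀1 (by omega))
        _ = τ * ((n + 1) * 2 ^ n * R₀ ^ n) := by simp; ring
        _ ≤ 1 / 2 := hτ1.le
    linarith
  · push Not at hp
    have hp1 : 1 ≤ |p| := hR₀1.trans hp.le
    obtain ⟨k, hk⟩ : ∃ k, n - j = k + 1 := ⟨n - j - 1, by omega⟩
    have key := sum_coeff_mul_choose_mul_pow hQ.le p j
    -- The condition j ≤ n/2 enters here: the powers p^i with i ≤ j are dominated by |p|^(n-j).
    have hrhs : |∑ i ∈ Finset.range (j + 1),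
          (-1 : ℝ) ^ i * (n - i).choose (j - i) * p ^ i * (taylor p Q).coeff i|
        ≤ 1 / 2 * |p| ^ (k + 1) := by
      calc _ ≤ ∑ i ∈ Finset.range (j + 1),
          |(-1 : ℝ) ^ i * (n - i).choose (j - i) * p ^ i * (taylor p Q).coeff i| :=
              Finset.abs_sum_le_sum_abs _ _
        _ ≤ ∑ i ∈ Finset.range (j + 1), 2 ^ n * |p| ^ (k + 1) * τ := by
            refine Finset.sum_le_sum fun i hi => ?_
            have hi' : i ≤ j := Nat.lt_succ_iff.1 (Finset.mem_range.1 hi)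
            rw [abs_mul, abs_mul, abs_mul, abs_pow, abs_pow, abs_neg, abs_one, one_pow, one_mul,
              Nat.abs_cast]
            refine mul_le_mul (mul_le_mul (choose_le_two_pow_real (by omega) _)
              (pow_le_pow_right₀ hp1 (by omega)) (by positivity) (by positivity)) (hq i)
              (abs_nonneg _) (by positivity)
        _ = τ * ((j + 1) * 2 ^ n) * |p| ^ (k + 1) := by simp; ring
        _ ≤ τ * ((n + 1) * 2 ^ n) * |p| ^ (k + 1) := by
            have : (j : ℝ) ≤ n := by exact_mod_cast (show j ≤ n by omega)
            gcongr
        _ ≤ _ := by gcongr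
    -- Terms with m > n - j vanish, and the term m = n - j has binomial factor 1.
    have hlhs : ∑ m ∈ Finset.range (n + 1), Q.coeff m * (n - m).choose j * p ^ m
        = ∑ m ∈ Finset.range (k + 1), Q.coeff m * (n - m).choose j * p ^ m
          + Q.coeff (k + 1) * p ^ (k + 1) := by
      have h1 : ∑ m ∈ Finset.range (n + 1), Q.coeff m * (n - m).choose j * p ^ m
          = ∑ m ∈ Finset.range (k + 2), Q.coeff m * (n - m).choose j * p ^ m := by
        symm
        refine Finset.sum_subset (Finset.range_mono (by omega)) fun m hm hm' => ?_
        rw [Finset.mem_range] at hm hm'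
        rw [Nat.choose_eq_zero_of_lt (n := n - m) (k := j) (by omega)]
        simp
      rw [h1, Finset.sum_range_succ, show n - (k + 1) = j by omega, Nat.choose_self]
      simp
    have hlow : |∑ m ∈ Finset.range (k + 1), Q.coeff m * (n - m).choose j * p ^ m|
        ≤ 2 ^ n * n * |p| ^ k := by
      calc _ ≤ ∑ m ∈ Finset.range (k + 1), |Q.coeff m * (n - m).choose j * p ^ m| :=
              Finset.abs_sum_le_sum_abs _ _
        _ ≤ ∑ m ∈ Finset.range (k + 1), 1 * 2 ^ n * |p| ^ k := by
            refine Finset.sum_le_sum fun m hm => ?_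
            have hm' : m ≤ k := Nat.lt_succ_iff.1 (Finset.mem_range.1 hm)
            rw [abs_mul, abs_mul, abs_pow, Nat.abs_cast]
            exact mul_le_mul (mul_le_mul (hle m) (choose_le_two_pow_real (by omega) _)
              (Nat.cast_nonneg _) zero_le_one) (pow_le_pow_right₀ hp1 hm') (by positivity)
              (by positivity)
        _ = 2 ^ n * (k + 1) * |p| ^ k := by simp; ring
        _ ≤ _ := by
            have : (k : ℝ) + 1 ≤ n := by exact_mod_cast (show k + 1 ≤ n by omega)
            gcongr
    have htop : |Q.coeff (k + 1) * p ^ (k + 1)| = |p| ^ (k + 1) := by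
      rw [abs_mul, ← hk, hone, one_mul, abs_pow]
    rw [hlhs] at key
    have h5 : |p| ^ (k + 1) ≤ 1 / 2 * |p| ^ (k + 1) + 2 ^ n * n * |p| ^ k := by
      have := eq_sub_of_add_eq' key
      calc |p| ^ (k + 1) = |Q.coeff (k + 1) * p ^ (k + 1)| := htop.symm
        _ = _ := congrArg abs this
        _ ≤ _ := (abs_sub _ _).trans (add_le_add hrhs hlow)
    have h6 : 0 < |p| ^ k := by positivity
    rw [pow_succ] at h5
    have h7 : |p| ≤ 2 ^ (n + 1) * n := by
      have : |p| ^ k * |p| ≤ |p| ^ k * (2 ^ (n + 1) * n) := by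
        rw [pow_succ (2:ℝ)]; linarith
      exact le_of_mul_le_mul_left this h6
    linarith

/-- A monic or semi-non-degenerating polynomial of degree `n` cannot be of size at most `(c ε) ^ n`
on a whole interval of length `n ε`. -/
theorem exists_pos_lt_abs_eval_on_Icc (n : ℕ) (hn : 1 ≤ n) :
    ∃ c : ℝ, 0 < c ∧ ∀ Q : ℝ[X], Q.natDegree = n → ∀ ε : ℝ, 0 < ε →
      (Q.Monic ∨ (IsSND Q ∧ ε ≤ 1)) → ∀ p : ℝ,
      ∃ y ∈ Icc p (p + n * ε), (c * ε) ^ n < |Q.eval y| := by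
  obtain ⟨K, hK, hKco⟩ := exists_abs_coeff_le_of_abs_eval_natCast_le n
  obtain ⟨τ, hτ, hτQ⟩ := exists_pos_lt_abs_taylor_coeff_of_isSND n hn
  set τ' := min τ (1 / 2) / K with hτ'
  have hτ'0 : 0 < τ' := by positivity
  set c := min τ' 1 with hc
  have hc0 : 0 < c := by positivity
  -- The bound τ serves the SND case and 1/2 the monic case.
  have hcn : K * c ^ n ≤ min τ (1 / 2) := by
    have h1 : c ^ n ≤ c := pow_le_of_le_one hc0.le (min_le_right _ _) (by omega)
    have h2 : c ≤ τ' := min_le_left _ _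
    calc K * c ^ n ≤ K * τ' := by gcongr; exact h1.trans h2
      _ = _ := by rw [hτ']; field_simp
  refine ⟨c, hc0, fun Q hQ ε hε hQε p => ?_⟩
  by_contra! hcon
  have hco : ∀ i, |(taylor p Q).coeff i * ε ^ i| ≤ K * (c * ε) ^ n := by
    intro i
    rw [← comp_C_mul_X_coeff]
    refine hKco _ ?_ _ ?_ i
    · refine natDegree_comp_le.trans ?_
      rw [natDegree_taylor, hQ]
      exact (Nat.mul_le_mul_left _ ((natDegree_C_mul_le ε X).trans natDegree_X_le)).trans (by omega)
    · intro l hl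
      simp only [eval_comp, eval_mul, eval_C, eval_X, taylor_eval]
      have hl' : (l : ℝ) ≤ n := by exact_mod_cast hl
      refine hcon _ ⟨?_, ?_⟩
      · have : 0 ≤ ε * l := by positivity
        linarith
      · nlinarith
  -- In the monic case the top Taylor coefficient is 1 and scales exactly like ε^n. In the SND case
  -- the large coefficient may have any index i ≤ n, and ε ≤ 1 is needed for ε^n ≤ ε^i.
  rcases hQε with hmon | ⟨hsnd, hε1⟩
  · have h1 := hco n
    have h2 : (taylor p Q).coeff n = 1 := by
      rw [← hQ, ← natDegree_taylor Q p, coeff_natDegree, leadingCoeff_taylor]; exact hmon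
    rw [h2, one_mul, abs_of_pos (by positivity), mul_pow, ← mul_assoc] at h1
    have h3 : 0 < ε ^ n := by positivity
    have h4 : K * c ^ n ≤ 1 / 2 := hcn.trans (min_le_right _ _)
    nlinarith
  · obtain ⟨i, hi, hlt⟩ := hτQ Q hQ hsnd p
    have h1 := hco i
    rw [abs_mul, abs_of_pos (by positivity : 0 < ε ^ i), mul_pow, ← mul_assoc] at h1
    have h2 : ε ^ n ≤ ε ^ i := pow_le_pow_of_le_one hε.le hε1 hi
    have h3 : |(taylor p Q).coeff i| * ε ^ i ≤ τ * ε ^ i :=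
      h1.trans (mul_le_mul (hcn.trans (min_le_left _ _)) h2 (by positivity) hτ.le)
    exact absurd (le_of_mul_le_mul_right h3 (by positivity)) (not_le.2 hlt)

/-! ### From oscillatory decay to sublevel sets -/

theorem integrable_abs_rpow_mul_exp_neg_sq {s : ℝ} (hs : -1 < s) :
    Integrable fun x : ℝ => |x| ^ s * Real.exp (-x ^ 2) := by
  have h := integrableOn_rpow_mul_exp_neg_mul_sq one_pos hs
  have h1 : IntegrableOn (fun x : ℝ => |x| ^ s * Real.exp (-x ^ 2)) (Ioi 0) := by
    refine h.congr_fun (fun x hx => ?_) measurableSet_Ioi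
    simp only [abs_of_pos (mem_Ioi.1 hx)]
    ring_nf
  rw [← integrableOn_univ, ← @Iio_union_Ici _ _ (0 : ℝ), integrableOn_union,
    integrableOn_Ici_iff_integrableOn_Ioi]
  refine ⟨?_, h1⟩
  rw [← (Measure.measurePreserving_neg (volume : Measure ℝ)).integrableOn_comp_preimage
      (Homeomorph.neg ℝ).measurableEmbedding]
  simpa [Function.comp_def] using h1

theorem gaussian_eq_integral (s : ℝ) :
    ∫ y : ℝ, Complex.exp (Complex.I * (s : ℂ) * y) * Complex.exp (-(y : ℂ) ^ 2)
      = ((Real.sqrt Real.pi * Real.exp (-s ^ 2 / 4) : ℝ) : ℂ) := by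
  have h := fourierIntegral_gaussian (b := 1) (by simp) (s : ℂ)
  simp only [neg_mul, one_mul, div_one, mul_one] at h
  rw [h]
  push_cast
  rw [Real.sqrt_eq_rpow, Complex.ofReal_cpow Real.pi_pos.le]
  push_cast
  rfl

theorem one_le_sqrt_pi_mul_exp {s : ℝ} (hs : |s| ≤ 1) :
    1 ≤ Real.sqrt Real.pi * Real.exp (-s ^ 2 / 4) := by
  have h1 : (3 / 2 : ℝ) ≤ Real.sqrt Real.pi := by
    apply Real.le_sqrt_of_sq_le
    linarith [Real.pi_gt_three]
  have h2 : s ^ 2 ≤ 1 := by rw [← sq_abs]; nlinarith [abs_nonneg s]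
  have h3 := Real.add_one_le_exp (-s ^ 2 / 4)
  nlinarith

/-- The Gaussian is a superposition of the exponentials e^{iy(f-c)/r}. After Fubini each frequency
costs at most A|y/r|^(-δ), which is integrable against the Gaussian weight because δ < 1. -/
theorem integral_gaussian_comp_le {a b δ A : ℝ} (hδ : δ < 1) {f : ℝ → ℝ}
    (hf : ContinuousOn f (Icc a b))
    (hA : ∀ t : ℝ, t ≠ 0 → ‖oscInt f (Icc a b) t‖ ≤ A * |t| ^ (-δ)) (c r : ℝ) (hr : 0 < r) :
    ∫ x in Icc a b, Real.sqrt Real.pi * Real.exp (-((f x - c) / r) ^ 2 / 4)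
      ≤ (∫ y : ℝ, |y| ^ (-δ) * Real.exp (-y ^ 2)) * A * r ^ δ := by
  set μ := volume.restrict (Icc a b) with hμ
  have hfm : AEStronglyMeasurable f μ := hf.aestronglyMeasurable measurableSet_Icc
  let F : ℝ → ℝ → ℂ := fun x y =>
    Complex.exp (Complex.I * (((f x - c) / r : ℝ) : ℂ) * y) * Complex.exp (-(y : ℂ) ^ 2)
  have hFn : ∀ x y, ‖F x y‖ = Real.exp (-y ^ 2) := by
    intro x y
    simp only [F, norm_mul]
    rw [show Complex.I * (((f x - c) / r : ℝ) : ℂ) * y = (((f x - c) / r * y : ℝ) : ℂ) * Complex.I by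
      push_cast; ring, Complex.norm_exp_ofReal_mul_I, one_mul,
      show -(y : ℂ) ^ 2 = ((-y ^ 2 : ℝ) : ℂ) by push_cast; ring, Complex.norm_exp_ofReal]
  have hgauss : Integrable fun y : ℝ => Real.exp (-y ^ 2) := by
    simpa using integrable_exp_neg_mul_sq one_pos
  have hFm : AEStronglyMeasurable (Function.uncurry F) (μ.prod volume) := by
    have h1 : AEStronglyMeasurable (fun z : ℝ × ℝ => f z.1) (μ.prod volume) := hfm.comp_fst
    have h2 : Continuous fun w : ℝ × ℝ =>
      Complex.exp (Complex.I * (((w.1 - c) / r : ℝ) : ℂ) * w.2) * Complex.exp (-(w.2 : ℂ) ^ 2) := by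
      fun_prop
    have h3 : AEStronglyMeasurable (fun z : ℝ × ℝ => z.2) (μ.prod (volume : Measure ℝ)) :=
      measurable_snd.aestronglyMeasurable
    have h4 := h2.comp_aestronglyMeasurable (h1.prodMk h3)
    exact h4
  have hFi : Integrable (Function.uncurry F) (μ.prod volume) := by
    have h1 : Integrable (fun z : ℝ × ℝ => (1 : ℝ) * Real.exp (-z.2 ^ 2)) (μ.prod volume) :=
      (integrable_const (1 : ℝ)).mul_prod hgauss
    refine h1.mono' hFm (Filter.Eventually.of_forall fun z => ?_)
    rw [Function.uncurry, hFn, one_mul]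
  have hswap := integral_integral_swap hFi
  have hleft : ∫ x, (∫ y, F x y) ∂μ
      = ((∫ x in Icc a b, Real.sqrt Real.pi * Real.exp (-((f x - c) / r) ^ 2 / 4) : ℝ) : ℂ) := by
    rw [← integral_complex_ofReal]
    refine integral_congr_ae (Filter.Eventually.of_forall fun x => ?_)
    exact gaussian_eq_integral _
  have hin : ∀ y : ℝ, ∫ x, F x y ∂μ = Complex.exp (-(y : ℂ) ^ 2) *
      Complex.exp (-(Complex.I * c / r * y)) * oscInt f (Icc a b) (y / r) := by
    intro y
    rw [oscInt, ← integral_const_mul]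
    refine integral_congr_ae (Filter.Eventually.of_forall fun x => ?_)
    simp only [F]
    rw [← Complex.exp_add, ← Complex.exp_add, ← Complex.exp_add]
    congr 1
    push_cast
    field_simp
    ring
  have hnorm : ∀ y : ℝ, y ≠ 0 → ‖∫ x, F x y ∂μ‖ ≤ A * r ^ δ * (|y| ^ (-δ) * Real.exp (-y ^ 2)) := by
    intro y hy
    rw [hin, norm_mul, norm_mul,
      show -(y : ℂ) ^ 2 = ((-y ^ 2 : ℝ) : ℂ) by push_cast; ring, Complex.norm_exp_ofReal,
      show -(Complex.I * c / r * y) = ((-(c / r * y) : ℝ) : ℂ) * Complex.I by push_cast; ring,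
      Complex.norm_exp_ofReal_mul_I, mul_one]
    have h1 := hA (y / r) (div_ne_zero hy hr.ne')
    have h2 : |y / r| ^ (-δ) = |y| ^ (-δ) * r ^ δ := by
      rw [abs_div, abs_of_pos hr, Real.div_rpow (abs_nonneg _) hr.le, Real.rpow_neg hr.le, div_inv_eq_mul]
    rw [h2] at h1
    calc _ ≤ Real.exp (-y ^ 2) * (A * (|y| ^ (-δ) * r ^ δ)) := by gcongr
      _ = _ := by ring
  have hfin : ‖∫ x, (∫ y, F x y) ∂μ‖ ≤ ∫ y : ℝ, A * r ^ δ * (|y| ^ (-δ) * Real.exp (-y ^ 2)) := by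
    rw [hswap]
    refine norm_integral_le_of_norm_le
      ((integrable_abs_rpow_mul_exp_neg_sq (by linarith)).const_mul _) ?_
    filter_upwards [Measure.ae_ne volume (0 : ℝ)] with y hy using hnorm y hy
  rw [hleft, Complex.norm_real] at hfin
  refine (le_abs_self _).trans (hfin.trans_eq ?_)
  rw [integral_const_mul]
  ring

/-- Decay of the oscillatory integral of `f` bounds the length of an interval on which `f` stays
within `r` of a constant. -/
theorem exists_length_le_of_oscInt_decay (δ : ℝ) (hδ : δ < 1) :
    ∃ K : ℝ, 0 < K ∧ ∀ (a b : ℝ) (f : ℝ → ℝ), ContinuousOn f (Icc a b) → ∀ A : ℝ, 0 ≤ A →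
      (∀ t : ℝ, t ≠ 0 → ‖oscInt f (Icc a b) t‖ ≤ A * |t| ^ (-δ)) →
      ∀ u v c r : ℝ, a ≤ u → u ≤ v → v ≤ b → 0 < r → (∀ x ∈ Ioo u v, |f x - c| ≤ r) →
        v - u ≤ K * A * r ^ δ := by
  set K := ∫ y : ℝ, |y| ^ (-δ) * Real.exp (-y ^ 2) with hK
  have hK0 : 0 ≤ K := integral_nonneg fun y => by positivity
  refine ⟨K + 1, by positivity, fun a b f hf A hA0 hA u v c r hu huv hv hr hc => ?_⟩
  set G : ℝ → ℝ := fun x => Real.sqrt Real.pi * Real.exp (-((f x - c) / r) ^ 2 / 4) with hG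
  have hGc : ContinuousOn G (Icc a b) := by fun_prop
  have hGi : IntegrableOn G (Icc a b) := hGc.integrableOn_Icc
  have hsub : Ioo u v ⊆ Icc a b := fun x hx => ⟨hu.trans hx.1.le, hx.2.le.trans hv⟩
  calc v - u = ∫ x in Ioo u v, (1 : ℝ) := by
        simp [Real.volume_real_Ioo_of_le huv]
    _ ≤ ∫ x in Ioo u v, G x := by
        refine setIntegral_mono_on (by simp) (hGi.mono_set hsub) measurableSet_Ioo fun x hx => ?_
        refine one_le_sqrt_pi_mul_exp ?_
        rw [abs_div, abs_of_pos hr, div_le_one hr]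
        exact hc x hx
    _ ≤ ∫ x in Icc a b, G x :=
        setIntegral_mono_set hGi (Filter.Eventually.of_forall fun x => by
          simp only [hG, Pi.zero_apply]; positivity) hsub.eventuallyLE
    _ ≤ K * A * r ^ δ := integral_gaussian_comp_le hδ hf hA c r hr
    _ ≤ (K + 1) * A * r ^ δ := by
        have : 0 ≤ r ^ δ := by positivity
        gcongr
        linarith

/-! ### First-derivative test -/

theorem SingleSignedOn.of_Ioo {g : ℝ → ℝ} {u v : ℝ} (huv : u < v) (hg : ContinuousOn g (Icc u v))
    (h : SingleSignedOn g (Ioo u v)) : SingleSignedOn g (Icc u v) := by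
  have key : ∀ T : Set ℝ, IsClosed T → (∀ x ∈ Ioo u v, g x ∈ T) → ∀ x ∈ Icc u v, g x ∈ T := by
    intro T hT h x hx
    have hcl : IsClosed (Icc u v ∩ g ⁻¹' T) := hg.preimage_isClosed_of_isClosed isClosed_Icc hT
    have hsub : closure (Ioo u v) ⊆ Icc u v ∩ g ⁻¹' T :=
      hcl.closure_subset_iff.2 fun y hy => ⟨Ioo_subset_Icc_self hy, h y hy⟩
    rw [closure_Ioo huv.ne] at hsub
    exact (hsub hx).2
  exact h.imp (key (Ici 0) isClosed_Ici) (key (Iic 0) isClosed_Iic)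

theorem integral_abs_deriv_le {g g' : ℝ → ℝ} {u v M : ℝ} (huv : u ≤ v)
    (hg : ContinuousOn g (Icc u v)) (hd : ∀ x ∈ Ioo u v, HasDerivAt g (g' x) x)
    (hg' : ContinuousOn g' (Icc u v)) (hs : SingleSignedOn g' (Icc u v))
    (hM : ∀ x ∈ Icc u v, |g x| ≤ M) : ∫ x in u..v, |g' x| ≤ 2 * M := by
  have hgint : IntervalIntegrable g' volume u v := hg'.intervalIntegrable_of_Icc huv
  have hftc := intervalIntegral.integral_eq_sub_of_hasDerivAt_of_le huv hg hd hgint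
  have hu := abs_le.1 (hM u ⟨le_rfl, huv⟩)
  have hv := abs_le.1 (hM v ⟨huv, le_rfl⟩)
  rcases hs with hs | hs
  · have : ∫ x in u..v, |g' x| = ∫ x in u..v, g' x := by
      refine intervalIntegral.integral_congr fun x hx => ?_
      rw [uIcc_of_le huv] at hx
      exact abs_of_nonneg (hs x hx)
    rw [this, hftc]; linarith
  · have : ∫ x in u..v, |g' x| = ∫ x in u..v, -g' x := by
      refine intervalIntegral.integral_congr fun x hx => ?_
      rw [uIcc_of_le huv] at hx
      exact abs_of_nonpos (hs x hx)
    rw [this, intervalIntegral.integral_neg, hftc]; linarith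

theorem abs_inv_le_of_le_abs {x η : ℝ} (hη : 0 < η) (h : η ≤ |x|) : |x⁻¹| ≤ η⁻¹ := by
  rw [abs_inv]; exact inv_anti₀ hη h

theorem singleSignedOn_neg_div_sq {g h : ℝ → ℝ} {s : Set ℝ} (hs : SingleSignedOn g s) :
    SingleSignedOn (fun x => -g x / h x ^ 2) s := by
  rcases hs with hs | hs
  · exact Or.inr fun x hx => div_nonpos_of_nonpos_of_nonneg (neg_nonpos.2 (hs x hx)) (sq_nonneg _)
  · exact Or.inl fun x hx => div_nonneg (neg_nonneg.2 (hs x hx)) (sq_nonneg _)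

/-- A first-derivative test of van der Corput type, for a phase whose derivative is the product of
two monotone functions that are bounded away from zero. -/
theorem norm_integral_exp_le_of_deriv_eq_mul {ψ α α' β β' : ℝ → ℝ} {u v η μ t : ℝ} (huv : u ≤ v)
    (hη : 0 < η) (hμ : 0 < μ) (ht : t ≠ 0)
    (hψ : ContinuousOn ψ (Icc u v)) (hψd : ∀ x ∈ Ioo u v, HasDerivAt ψ (α x * β x) x)
    (hα : ContinuousOn α (Icc u v)) (hαd : ∀ x ∈ Ioo u v, HasDerivAt α (α' x) x)
    (hα' : ContinuousOn α' (Icc u v)) (hαs : SingleSignedOn α' (Icc u v))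
    (hαη : ∀ x ∈ Icc u v, η ≤ |α x|)
    (hβ : ContinuousOn β (Icc u v)) (hβd : ∀ x ∈ Ioo u v, HasDerivAt β (β' x) x)
    (hβ' : ContinuousOn β' (Icc u v)) (hβs : SingleSignedOn β' (Icc u v))
    (hβμ : ∀ x ∈ Icc u v, μ ≤ |β x|) :
    ‖∫ x in u..v, Complex.exp (Complex.I * (t : ℂ) * (ψ x : ℂ))‖ ≤ 6 / (|t| * η * μ) := by
  have hα0 : ∀ x ∈ Icc u v, α x ≠ 0 := fun x hx => abs_pos.1 (hη.trans_le (hαη x hx))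
  have hβ0 : ∀ x ∈ Icc u v, β x ≠ 0 := fun x hx => abs_pos.1 (hμ.trans_le (hβμ x hx))
  set A : ℝ → ℝ := fun x => (α x)⁻¹ with hAdef
  set B : ℝ → ℝ := fun x => (β x)⁻¹ with hBdef
  set A' : ℝ → ℝ := fun x => -α' x / α x ^ 2 with hA'def
  set B' : ℝ → ℝ := fun x => -β' x / β x ^ 2 with hB'def
  have hA : ContinuousOn A (Icc u v) := hα.inv₀ hα0
  have hB : ContinuousOn B (Icc u v) := hβ.inv₀ hβ0
  have hA' : ContinuousOn A' (Icc u v) := hα'.neg.div (hα.pow 2) fun x hx => pow_ne_zero 2 (hα0 x hx)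
  have hB' : ContinuousOn B' (Icc u v) := hβ'.neg.div (hβ.pow 2) fun x hx => pow_ne_zero 2 (hβ0 x hx)
  have hAd : ∀ x ∈ Ioo u v, HasDerivAt A (A' x) x := fun x hx =>
    (hαd x hx).inv (hα0 x (Ioo_subset_Icc_self hx))
  have hBd : ∀ x ∈ Ioo u v, HasDerivAt B (B' x) x := fun x hx =>
    (hβd x hx).inv (hβ0 x (Ioo_subset_Icc_self hx))
  have hAM : ∀ x ∈ Icc u v, |A x| ≤ η⁻¹ := fun x hx => abs_inv_le_of_le_abs hη (hαη x hx)
  have hBM : ∀ x ∈ Icc u v, |B x| ≤ μ⁻¹ := fun x hx => abs_inv_le_of_le_abs hμ (hβμ x hx)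
  have hIA : ∫ x in u..v, |A' x| ≤ 2 * η⁻¹ :=
    integral_abs_deriv_le huv hA hAd hA' (singleSignedOn_neg_div_sq hαs) hAM
  have hIB : ∫ x in u..v, |B' x| ≤ 2 * μ⁻¹ :=
    integral_abs_deriv_le huv hB hBd hB' (singleSignedOn_neg_div_sq hβs) hBM
  have htC : (t : ℂ) ≠ 0 := by exact_mod_cast ht
  have hIt : Complex.I * (t : ℂ) ≠ 0 := mul_ne_zero Complex.I_ne_zero htC
  set E : ℝ → ℂ := fun x => Complex.exp (Complex.I * (t : ℂ) * (ψ x : ℂ)) with hE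
  have hψC : ContinuousOn (fun x => (ψ x : ℂ)) (Icc u v) := Complex.continuous_ofReal.comp_continuousOn hψ
  have hEc : ContinuousOn E (Icc u v) :=
    Complex.continuous_exp.comp_continuousOn (continuousOn_const.mul hψC)
  have hEn : ∀ x, ‖E x‖ = 1 := by
    intro x
    simp only [hE]
    rw [show Complex.I * (t : ℂ) * (ψ x : ℂ) = ((t * ψ x : ℝ) : ℂ) * Complex.I by push_cast; ring,
      Complex.norm_exp_ofReal_mul_I]
  set V : ℝ → ℂ := fun x => E x / (Complex.I * t) with hV
  have hVn : ∀ x, ‖V x‖ = |t|⁻¹ := by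
    intro x
    simp [hV, hEn]
  set W : ℝ → ℂ := fun x => ((A x * B x : ℝ) : ℂ) with hW
  set W' : ℝ → ℂ := fun x => ((A' x * B x + A x * B' x : ℝ) : ℂ) with hW'
  set V' : ℝ → ℂ := fun x => ((α x * β x : ℝ) : ℂ) * E x with hV'
  have hWc : ContinuousOn W (Icc u v) := Complex.continuous_ofReal.comp_continuousOn (hA.mul hB)
  have hW'c : ContinuousOn W' (Icc u v) :=
    Complex.continuous_ofReal.comp_continuousOn ((hA'.mul hB).add (hA.mul hB'))
  have hVc : ContinuousOn V (Icc u v) := hEc.div_const _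
  have hV'c : ContinuousOn V' (Icc u v) :=
    (Complex.continuous_ofReal.comp_continuousOn (hα.mul hβ)).mul hEc
  have hWd : ∀ x ∈ Ioo u v, HasDerivAt W (W' x) x := fun x hx =>
    ((hAd x hx).mul (hBd x hx)).ofReal_comp
  have hVd : ∀ x ∈ Ioo u v, HasDerivAt V (V' x) x := by
    intro x hx
    have h1 : HasDerivAt (fun x => (ψ x : ℂ)) ((α x * β x : ℝ) : ℂ) x := (hψd x hx).ofReal_comp
    have h2 := ((h1.const_mul (Complex.I * (t : ℂ))).cexp).div_const (Complex.I * (t : ℂ))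
    refine h2.congr_deriv ?_
    rw [div_eq_iff hIt]
    simp only [V', E]
    ring
  have hparts := intervalIntegral.integral_mul_deriv_eq_deriv_mul_of_hasDerivAt
    (u := W) (v := V) (u' := W') (v' := V') (a := u) (b := v)
    (by rwa [uIcc_of_le huv]) (by rwa [uIcc_of_le huv])
    (by rwa [min_eq_left huv, max_eq_right huv]) (by rwa [min_eq_left huv, max_eq_right huv])
    (hW'c.intervalIntegrable_of_Icc huv) (hV'c.intervalIntegrable_of_Icc huv)
  -- The integrand is (1/ψ')·(ψ' e^{itψ}). Parts give two boundary terms and a remainder in which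
  -- each reciprocal factor has total variation at most twice its supremum: 2 + 4 = 6.
  have hWV : ∫ x in u..v, E x = ∫ x in u..v, W x * V' x := by
    refine intervalIntegral.integral_congr fun x hx => ?_
    rw [uIcc_of_le huv] at hx
    have h1 : A x * B x * (α x * β x) = 1 := by
      simp only [hAdef, hBdef]
      field_simp [hα0 x hx, hβ0 x hx]
    simp only [hW, hV']
    rw [← mul_assoc, ← Complex.ofReal_mul, h1, Complex.ofReal_one, one_mul]
  have hWn : ∀ x ∈ Icc u v, ‖W x * V x‖ ≤ η⁻¹ * μ⁻¹ * |t|⁻¹ := by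
    intro x hx
    rw [norm_mul, hVn, hW, Complex.norm_real, Real.norm_eq_abs, abs_mul]
    have := hAM x hx
    have := hBM x hx
    gcongr
  have hrem : ‖∫ x in u..v, W' x * V x‖ ≤ 4 * (η⁻¹ * μ⁻¹ * |t|⁻¹) := by
    have hb : ∀ x ∈ Icc u v, ‖W' x * V x‖ ≤ (μ⁻¹ * |A' x| + η⁻¹ * |B' x|) * |t|⁻¹ := by
      intro x hx
      rw [norm_mul, hVn, hW', Complex.norm_real, Real.norm_eq_abs]
      refine mul_le_mul_of_nonneg_right ((abs_add_le _ _).trans ?_) (by positivity)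
      rw [abs_mul, abs_mul, mul_comm |A' x|]
      have := hAM x hx
      have := hBM x hx
      gcongr
    have hiA : IntervalIntegrable (fun x => |A' x|) volume u v :=
      hA'.abs.intervalIntegrable_of_Icc huv
    have hiB : IntervalIntegrable (fun x => |B' x|) volume u v :=
      hB'.abs.intervalIntegrable_of_Icc huv
    have hi := ((hiA.const_mul μ⁻¹).add (hiB.const_mul η⁻¹)).mul_const |t|⁻¹
    calc _ ≤ ∫ x in u..v, (μ⁻¹ * |A' x| + η⁻¹ * |B' x|) * |t|⁻¹ :=
          intervalIntegral.norm_integral_le_of_norm_le huv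
            (Filter.Eventually.of_forall fun x hx => hb x (Ioc_subset_Icc_self hx)) hi
      _ = (μ⁻¹ * (∫ x in u..v, |A' x|) + η⁻¹ * ∫ x in u..v, |B' x|) * |t|⁻¹ := by
          rw [intervalIntegral.integral_mul_const, intervalIntegral.integral_add
            (hiA.const_mul _) (hiB.const_mul _), intervalIntegral.integral_const_mul,
            intervalIntegral.integral_const_mul]
      _ ≤ (μ⁻¹ * (2 * η⁻¹) + η⁻¹ * (2 * μ⁻¹)) * |t|⁻¹ := by gcongr
      _ = _ := by ring
  rw [hWV, hparts]
  have h1 := hWn v ⟨huv, le_rfl⟩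
  have h2 := hWn u ⟨le_rfl, huv⟩
  have h3 := norm_sub_le (W v * V v - W u * V u) (∫ x in u..v, W' x * V x)
  have h4 := norm_sub_le (W v * V v) (W u * V u)
  have h5 : 6 / (|t| * η * μ) = 6 * (η⁻¹ * μ⁻¹ * |t|⁻¹) := by
    rw [div_eq_mul_inv, mul_inv, mul_inv]; ring
  rw [h5]
  linarith

/-! ### Sign partitions for the derivatives of f -/

section IteratedDeriv

variable {f : ℝ → ℝ} {a b : ℝ}

theorem ContDiffOn.continuousOn_iteratedDerivWithin_Icc (hf : ContDiffOn ℝ ∞ f (Icc a b))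
    (hab : a < b) (k : ℕ) : ContinuousOn (iteratedDerivWithin k f (Icc a b)) (Icc a b) :=
  hf.continuousOn_iteratedDerivWithin (by exact_mod_cast le_top) (uniqueDiffOn_Icc hab)

theorem ContDiffOn.hasDerivAt_iteratedDerivWithin_Icc (hf : ContDiffOn ℝ ∞ f (Icc a b))
    (hab : a < b) (k : ℕ) {x : ℝ} (hx : x ∈ Ioo a b) :
    HasDerivAt (iteratedDerivWithin k f (Icc a b)) (iteratedDerivWithin (k + 1) f (Icc a b) x) x := by
  have h1 : DifferentiableOn ℝ (iteratedDerivWithin k f (Icc a b)) (Icc a b) :=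
    hf.differentiableOn_iteratedDerivWithin (by exact_mod_cast WithTop.coe_lt_top k)
      (uniqueDiffOn_Icc hab)
  rw [iteratedDerivWithin_succ]
  exact (h1 x (Ioo_subset_Icc_self hx)).hasDerivWithinAt.hasDerivAt (Icc_mem_nhds hx.1 hx.2)

theorem signPartition_iteratedDerivWithin {N : ℕ} (hf : ContDiffOn ℝ ∞ f (Icc a b)) (hab : a < b)
    (hs : SingleSignedOn (iteratedDerivWithin N f (Icc a b)) (Icc a b)) :
    ∀ i k : ℕ, k + i = N → ∀ u v, a ≤ u → u ≤ v → v ≤ b →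
      SignPartition {iteratedDerivWithin k f (Icc a b)} (2 ^ i) u v
  | 0, k, hk, u, v, hu, huv, hv => by
    obtain rfl : k = N := by omega
    refine SignPartition.single (n := 0) huv ?_
    rintro _ rfl
    exact hs.mono (Ioo_subset_Icc_self.trans (Icc_subset_Icc hu hv))
  | i + 1, k, hk, u, v, hu, huv, hv => by
    have ih := signPartition_iteratedDerivWithin hf hab hs i (k + 1) (by omega) u v hu huv hv
    have := ih.antideriv ((hf.continuousOn_iteratedDerivWithin_Icc hab k).mono
      (Icc_subset_Icc hu hv)) (fun x hx => hf.hasDerivAt_iteratedDerivWithin_Icc hab k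
        (Ioo_subset_Ioo hu hv hx)) 0
    simpa [pow_succ] using this

theorem signPartition_iteratedDerivWithin_sub {N : ℕ} (hf : ContDiffOn ℝ ∞ f (Icc a b))
    (hab : a < b) (hs : SingleSignedOn (iteratedDerivWithin N f (Icc a b)) (Icc a b))
    {k : ℕ} (hk : k < N) (c : ℝ) {u v : ℝ} (hu : a ≤ u) (huv : u ≤ v) (hv : v ≤ b) :
    SignPartition {fun x => iteratedDerivWithin k f (Icc a b) x - c} (2 ^ (N - k)) u v := by
  have ih := signPartition_iteratedDerivWithin hf hab hs (N - (k + 1)) (k + 1) (by omega)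
    u v hu huv hv
  have := ih.antideriv ((hf.continuousOn_iteratedDerivWithin_Icc hab k).mono
    (Icc_subset_Icc hu hv)) (fun x hx => hf.hasDerivAt_iteratedDerivWithin_Icc hab k
      (Ioo_subset_Ioo hu hv hx)) c
  rwa [← pow_succ, show N - (k + 1) + 1 = N - k by omega] at this

end IteratedDeriv

/-! ### Estimate on one piece -/

theorem le_abs_or_abs_le_of_singleSignedOn {g : ℝ → ℝ} {s : Set ℝ} {μ : ℝ} (hμ : 0 < μ)
    (h₁ : SingleSignedOn (fun x => g x - μ) s) (h₂ : SingleSignedOn (fun x => g x - -μ) s) :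
    ((∀ x ∈ s, μ ≤ |g x|) ∧ SingleSignedOn g s) ∨ ∀ x ∈ s, |g x| ≤ μ := by
  rcases h₁ with h₁ | h₁
  · have : ∀ x ∈ s, μ ≤ g x := fun x hx => by have := h₁ x hx; simp only at this; linarith
    exact Or.inl ⟨fun x hx => (this x hx).trans (le_abs_self _),
      Or.inl fun x hx => hμ.le.trans (this x hx)⟩
  rcases h₂ with h₂ | h₂
  · refine Or.inr fun x hx => abs_le.2 ⟨?_, ?_⟩
    · have := h₂ x hx; simp only at this; linarith
    · have := h₁ x hx; simp only at this; linarith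
  · have : ∀ x ∈ s, g x ≤ -μ := fun x hx => by have := h₂ x hx; simp only at this; linarith
    exact Or.inl ⟨fun x hx => (by linarith [this x hx] : μ ≤ -g x).trans (neg_le_abs _),
      Or.inr fun x hx => (this x hx).trans (by linarith)⟩

theorem SingleSignedOn.mul {g h : ℝ → ℝ} {s : Set ℝ} (hg : SingleSignedOn g s)
    (hh : SingleSignedOn h s) : SingleSignedOn (fun x => g x * h x) s := by
  rcases hg with hg | hg <;> rcases hh with hh | hh
  · exact Or.inl fun x hx => mul_nonneg (hg x hx) (hh x hx)
  · exact Or.inr fun x hx => mul_nonpos_of_nonneg_of_nonpos (hg x hx) (hh x hx)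
  · exact Or.inr fun x hx => mul_nonpos_of_nonpos_of_nonneg (hg x hx) (hh x hx)
  · exact Or.inl fun x hx => mul_nonneg_of_nonpos_of_nonpos (hg x hx) (hh x hx)

theorem norm_integral_exp_I_mul_le (t : ℝ) (φ : ℝ → ℝ) {u v : ℝ} (huv : u ≤ v) :
    ‖∫ x in u..v, Complex.exp (Complex.I * (t : ℂ) * (φ x : ℂ))‖ ≤ v - u := by
  have h := intervalIntegral.norm_integral_le_of_norm_le_const (a := u) (b := v) (C := 1)
    (f := fun x => Complex.exp (Complex.I * (t : ℂ) * (φ x : ℂ))) fun x _ => by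
      rw [show Complex.I * (t : ℂ) * (φ x : ℂ) = ((t * φ x : ℝ) : ℂ) * Complex.I by
        push_cast; ring, Complex.norm_exp_ofReal_mul_I]
  rwa [one_mul, abs_of_nonneg (sub_nonneg.2 huv)] at h

/-- The functions whose signs have to be controlled in order to estimate the oscillatory integral
with phase `P ∘ f`, where `f₁` and `f₂` are the first two derivatives of `f`. -/
def controlFamily (P : ℝ[X]) (f f₁ f₂ : ℝ → ℝ) (η μ : ℝ) : Set (ℝ → ℝ) :=
  {f₂} ∪ {fun x => f₁ x - μ} ∪ {fun x => f₁ x - -μ}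
    ∪ {fun x => (derivative P - C η).eval (f x)}
    ∪ {fun x => (derivative P - C (-η)).eval (f x)}
    ∪ {fun x => (derivative (derivative P)).eval (f x)}

theorem norm_integral_exp_eval_comp_le {P : ℝ[X]} {f f₁ f₂ : ℝ → ℝ} {u v η μ t B : ℝ}
    (huv : u < v) (hη : 0 < η) (hμ : 0 < μ) (ht : t ≠ 0)
    (hf : ContinuousOn f (Icc u v)) (hfd : ∀ x ∈ Ioo u v, HasDerivAt f (f₁ x) x)
    (hf₁ : ContinuousOn f₁ (Icc u v)) (hf₁d : ∀ x ∈ Ioo u v, HasDerivAt f₁ (f₂ x) x)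
    (hf₂ : ContinuousOn f₂ (Icc u v))
    (hF : ∀ g ∈ controlFamily P f f₁ f₂ η μ, SingleSignedOn g (Ioo u v))
    (hB₁ : (∀ x ∈ Ioo u v, |f₁ x| ≤ μ) → v - u ≤ B)
    (hB₂ : (∀ x ∈ Ioo u v, |(derivative P).eval (f x)| ≤ η) → v - u ≤ B)
    (hB₃ : 6 / (|t| * η * μ) ≤ B) :
    ‖∫ x in u..v, Complex.exp (Complex.I * (t : ℂ) * ((P.eval (f x) : ℝ) : ℂ))‖ ≤ B := by
  have hev : ∀ R : ℝ[X], ContinuousOn (fun x => R.eval (f x)) (Icc u v) := fun R =>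
    R.continuous.comp_continuousOn hf
  have s₁ : SingleSignedOn f₂ (Icc u v) :=
    .of_Ioo huv hf₂ (hF _ (by simp [controlFamily]))
  have s₂ : SingleSignedOn (fun x => f₁ x - μ) (Icc u v) :=
    .of_Ioo huv (hf₁.sub continuousOn_const) (hF _ (by simp [controlFamily]))
  have s₃ : SingleSignedOn (fun x => f₁ x - -μ) (Icc u v) :=
    .of_Ioo huv (hf₁.sub continuousOn_const) (hF _ (by simp [controlFamily]))
  have s₄ : SingleSignedOn (fun x => (derivative P - C η).eval (f x)) (Icc u v) :=
    .of_Ioo huv (hev _) (hF _ (by simp [controlFamily]))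
  have s₅ : SingleSignedOn (fun x => (derivative P - C (-η)).eval (f x)) (Icc u v) :=
    .of_Ioo huv (hev _) (hF _ (by simp [controlFamily]))
  have s₆ : SingleSignedOn (fun x => (derivative (derivative P)).eval (f x)) (Icc u v) :=
    .of_Ioo huv (hev _) (hF _ (by simp [controlFamily]))
  simp only [eval_sub, eval_C] at s₄ s₅
  rcases le_abs_or_abs_le_of_singleSignedOn hμ s₂ s₃ with ⟨hf₁μ, hf₁s⟩ | h
  swap
  · exact (norm_integral_exp_I_mul_le t _ huv.le).trans
      (hB₁ fun x hx => h x (Ioo_subset_Icc_self hx))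
  rcases le_abs_or_abs_le_of_singleSignedOn hη s₄ s₅ with ⟨hQη, -⟩ | h
  swap
  · exact (norm_integral_exp_I_mul_le t _ huv.le).trans
      (hB₂ fun x hx => h x (Ioo_subset_Icc_self hx))
  refine (norm_integral_exp_le_of_deriv_eq_mul (ψ := fun x => P.eval (f x))
    (α := fun x => (derivative P).eval (f x))
    (α' := fun x => (derivative (derivative P)).eval (f x) * f₁ x) (β := f₁) (β' := f₂)
    huv.le hη hμ ht (hev P) ?_ (hev _) ?_ ((hev _).mul hf₁) (s₆.mul hf₁s) hQη hf₁ hf₁d hf₂ s₁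
    hf₁μ).trans hB₃
  · exact fun x hx => (P.hasDerivAt (f x)).comp x (hfd x hx)
  · exact fun x hx => ((derivative P).hasDerivAt (f x)).comp x (hfd x hx)

theorem signPartition_controlFamily {f : ℝ → ℝ} {a b : ℝ} {N n : ℕ} (hN : 2 ≤ N)
    (hf : ContDiffOn ℝ ∞ f (Icc a b)) (hab : a < b)
    (hs : SingleSignedOn (iteratedDerivWithin N f (Icc a b)) (Icc a b))
    (P : ℝ[X]) (hP : (derivative P).natDegree = n) (η μ : ℝ) :
    SignPartition (controlFamily P f (iteratedDerivWithin 1 f (Icc a b))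
        (iteratedDerivWithin 2 f (Icc a b)) η μ)
      (2 ^ (N - 2) * 2 ^ (N - 1) * 2 ^ (N - 1) * (2 ^ N) ^ n * (2 ^ N) ^ n * (2 ^ N) ^ n) a b := by
  have h₂ := signPartition_iteratedDerivWithin hf hab hs (N - 2) 2 (by omega)
  have h₁ := fun c u v (hu : a ≤ u) (huv : u ≤ v) (hv : v ≤ b) =>
    signPartition_iteratedDerivWithin_sub hf hab hs (k := 1) (by omega) c hu huv hv
  have h₀ : ∀ c u v, a ≤ u → u ≤ v → v ≤ b → SignPartition {fun x => f x - c} (2 ^ N) u v := by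
    intro c u v hu huv hv
    have := signPartition_iteratedDerivWithin_sub hf hab hs (k := 0) (by omega) c hu huv hv
    simpa using this
  have hev : ∀ R : ℝ[X], R.natDegree ≤ n → ∀ u v, a ≤ u → u ≤ v → v ≤ b →
      SignPartition {fun x => R.eval (f x)} ((2 ^ N) ^ n) u v := fun R hR u v hu huv hv =>
    SignPartition.eval_comp huv Nat.one_le_two_pow
      (fun c u' v' hu' huv' hv' => h₀ c u' v' (hu.trans hu') huv' (hv'.trans hv)) R hR
  refine (((((h₂ a b le_rfl hab.le le_rfl).union (h₁ μ)).union (h₁ (-μ))).union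
    (hev _ ?_)).union (hev _ ?_)).union (hev _ ?_)
  · rw [natDegree_sub_C, hP]
  · rw [natDegree_sub_C, hP]
  · exact (natDegree_derivative_le _).trans (by omega)

/-! ### Length bounds and balancing -/

/-- The image of f is an interval on which |Q| ≤ η, so it cannot contain an interval of length ℓ. -/
theorem abs_sub_le_of_abs_eval_comp_le {Q : ℝ[X]} {f : ℝ → ℝ} {u v η ℓ : ℝ}
    (hf : ContinuousOn f (Ioo u v)) (hη : ∀ x ∈ Ioo u v, |Q.eval (f x)| ≤ η)
    (hQ : ∀ p : ℝ, ∃ y ∈ Icc p (p + ℓ), η < |Q.eval y|) {x y : ℝ} (hx : x ∈ Ioo u v)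
    (hy : y ∈ Ioo u v) : |f x - f y| ≤ ℓ := by
  have key : ∀ x ∈ Ioo u v, ∀ y ∈ Ioo u v, f y ≤ f x + ℓ := by
    intro x hx y hy
    by_contra! hlt
    obtain ⟨z, hz, hz'⟩ := hQ (f x)
    have hconn : (f '' Ioo u v).OrdConnected :=
      (isPreconnected_Ioo.image f hf).ordConnected
    obtain ⟨w, hw, rfl⟩ := hconn.out (mem_image_of_mem f hx) (mem_image_of_mem f hy)
      ⟨hz.1, hz.2.trans hlt.le⟩
    exact absurd (hη w hw) (not_le.2 hz')
  rw [abs_le]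
  constructor <;> linarith [key x hx y hy, key y hy x hx]

/-- Solves the self-referential bound of the case |f'| ≤ μ, where L appears on both sides. This is
the source of the power 1/(1-δ) of A. -/
theorem le_of_le_mul_rpow {L K A ε δ : ℝ} (hδ : δ < 1) (hL : 0 < L) (hK : 0 < K) (hA : 0 < A)
    (hε : 0 < ε) (h : L ≤ K * A * (ε ^ (1 - δ) * L) ^ δ) :
    L ≤ K ^ (1 / (1 - δ)) * A ^ (1 / (1 - δ)) * ε ^ δ := by
  have hδ' : 0 < 1 - δ := by linarith
  have h1 : L ^ (1 - δ) ≤ K * A * ε ^ ((1 - δ) * δ) := by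
    rw [Real.mul_rpow (by positivity) hL.le, ← Real.rpow_mul hε.le, ← mul_assoc] at h
    rw [Real.rpow_sub hL, Real.rpow_one, div_le_iff₀ (by positivity)]
    exact h
  have h2 := Real.rpow_le_rpow (by positivity) h1 (by positivity : 0 ≤ 1 / (1 - δ))
  rw [← Real.rpow_mul hL.le, mul_one_div_cancel hδ'.ne', Real.rpow_one,
    Real.mul_rpow (by positivity) (by positivity), Real.mul_rpow hK.le hA.le,
    ← Real.rpow_mul hε.le] at h2
  rwa [show (1 - δ) * δ * (1 / (1 - δ)) = δ by field_simp] at h2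

/-- For δ < 0 the length bound K A r^δ tends to 0 as r → ∞, while every large r is admissible since
f is bounded. -/
theorem eq_of_oscInt_decay_of_neg {a b δ A : ℝ} (hab : a ≤ b) (hδ : δ < 0) {f : ℝ → ℝ}
    (hf : ContinuousOn f (Icc a b)) (hA : 0 ≤ A)
    (hdec : ∀ t : ℝ, t ≠ 0 → ‖oscInt f (Icc a b) t‖ ≤ A * |t| ^ (-δ)) : a = b := by
  obtain ⟨K, hK, hlen⟩ := exists_length_le_of_oscInt_decay δ (by linarith)
  obtain ⟨M, hM⟩ := isCompact_Icc.exists_bound_of_continuousOn hf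
  have h1 : ∀ᶠ r : ℝ in Filter.atTop, b - a ≤ K * A * r ^ δ := by
    filter_upwards [Filter.eventually_ge_atTop M, Filter.eventually_gt_atTop 0] with r hr hr0
    refine hlen a b f hf A hA hdec a b 0 r le_rfl hab le_rfl hr0 fun x hx => ?_
    rw [sub_zero]
    exact (hM x (Ioo_subset_Icc_self hx)).trans hr
  have h2 : Filter.Tendsto (fun r : ℝ => K * A * r ^ δ) Filter.atTop (nhds (K * A * 0)) := by
    have := tendsto_rpow_neg_atTop (y := -δ) (by linarith)
    rw [neg_neg] at this
    exact this.const_mul _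
  have h3 := ge_of_tendsto h2 h1
  rw [mul_zero] at h3
  linarith

theorem oscInt_Icc_eq_intervalIntegral {a b : ℝ} (hab : a ≤ b) (φ : ℝ → ℝ) (t : ℝ) :
    oscInt φ (Icc a b) t = ∫ x in a..b, Complex.exp (Complex.I * (t : ℂ) * (φ x : ℂ)) := by
  rw [oscInt, integral_Icc_eq_integral_Ioc, intervalIntegral.integral_of_le hab]

/-- The estimate for both classes of polynomials at once. -/
theorem exists_norm_oscInt_eval_comp_le (d N : ℕ) (hd : 2 ≤ d) (hN : 2 ≤ N) (δ : ℝ) (hδ : δ < 1)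
    (hδ0 : 0 ≤ δ) :
    ∃ C : ℝ, 0 < C ∧ ∀ (a b : ℝ), a < b → ∀ f : ℝ → ℝ, ContDiffOn ℝ ∞ f (Icc a b) →
      SingleSignedOn (iteratedDerivWithin N f (Icc a b)) (Icc a b) → ∀ A : ℝ, 1 ≤ A →
      (∀ t : ℝ, t ≠ 0 → ‖oscInt f (Icc a b) t‖ ≤ A * |t| ^ (-δ)) →
      ∀ P : ℝ[X], P.natDegree = d → ∀ t : ℝ, t ≠ 0 →
        ((derivative P).Monic ∨ (IsSND (derivative P) ∧ 1 ≤ |t|)) →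
          ‖oscInt (fun x => P.eval (f x)) (Icc a b) t‖
            ≤ C * A ^ (1 / (1 - δ)) * |t| ^ (-δ / (d : ℝ)) := by
  obtain ⟨K, hK, hlen⟩ := exists_length_le_of_oscInt_decay δ hδ
  obtain ⟨n, rfl⟩ : ∃ n, d = n + 1 := ⟨d - 1, by omega⟩
  have hn : 1 ≤ n := by omega
  have hn0 : (0 : ℝ) < n := by exact_mod_cast hn
  obtain ⟨c, hc, hpoly⟩ := exists_pos_lt_abs_eval_on_Icc n hn
  set M : ℕ := 2 ^ (N - 2) * 2 ^ (N - 1) * 2 ^ (N - 1) * (2 ^ N) ^ n * (2 ^ N) ^ n * (2 ^ N) ^ n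
    with hM
  have hM0 : 0 < M := by positivity
  -- One summand for each case: small f', small Q(f), and both large.
  set K' : ℝ := K ^ (1 / (1 - δ)) + K * (n : ℝ) ^ δ + 6 / c ^ n with hK'
  refine ⟨M * K', by positivity, ?_⟩
  intro a b hab f hf hs A hA hdec P hP t ht hQ
  have hA0 : 0 < A := by linarith
  have hfc : ContinuousOn f (Icc a b) := hf.continuousOn
  have hQdeg : (derivative P).natDegree = n := by
    rw [natDegree_derivative, hP]; rfl
  have ht0 : 0 < |t| := abs_pos.2 ht
  set ε : ℝ := |t| ^ (-1 / ((n + 1 : ℕ) : ℝ)) with hεdef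
  have hε : 0 < ε := Real.rpow_pos_of_pos ht0 _
  have hεd : ε ^ (n + 1) = |t|⁻¹ := by
    rw [hεdef, ← Real.rpow_natCast, ← Real.rpow_mul ht0.le, div_mul_cancel₀ _ (by positivity),
      Real.rpow_neg_one]
  have hεδ : |t| ^ (-δ / ((n + 1 : ℕ) : ℝ)) = ε ^ δ := by
    rw [hεdef, ← Real.rpow_mul ht0.le]; congr 1; ring
  have hQ' : (derivative P).Monic ∨ (IsSND (derivative P) ∧ ε ≤ 1) := by
    refine hQ.imp id fun h => ⟨h.1, ?_⟩
    exact Real.rpow_le_one_of_one_le_of_nonpos h.2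
      (div_nonpos_of_nonpos_of_nonneg (by norm_num) (by positivity))
  set A' : ℝ := A ^ (1 / (1 - δ)) with hA'def
  -- Here δ ≥ 0 matters: the last two cases cost only A and 1, which A^(1/(1-δ)) must absorb.
  have hexp : 1 ≤ 1 / (1 - δ) := by
    rw [le_div_iff₀ (by linarith)]; linarith
  have hAA' : A ≤ A' := by
    calc A = A ^ (1 : ℝ) := (Real.rpow_one A).symm
      _ ≤ A' := Real.rpow_le_rpow_of_exponent_le hA hexp
  have hA'1 : 1 ≤ A' := hA.trans hAA'
  set η : ℝ := (c * ε) ^ n with hηdef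
  set μ : ℝ := ε ^ (1 - δ) with hμdef
  have hη : 0 < η := by positivity
  have hμ : 0 < μ := by positivity
  have hpart := signPartition_controlFamily hN hf hab hs P hQdeg η μ
  have hεδ0 : 0 < ε ^ δ := by positivity
  have hB₁ : K ^ (1 / (1 - δ)) * A' * ε ^ δ ≤ K' * A' * ε ^ δ := by
    gcongr
    rw [hK', add_assoc]
    exact le_add_of_nonneg_right (by positivity)
  have hB₂ : K * (n : ℝ) ^ δ * A' * ε ^ δ ≤ K' * A' * ε ^ δ := by
    gcongr
    have : 0 ≤ K ^ (1 / (1 - δ)) := by positivity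
    have : 0 ≤ 6 / c ^ n := by positivity
    rw [hK']; linarith
  have hB₃ : 6 / (|t| * η * μ) ≤ K' * A' * ε ^ δ := by
    have h1 : 6 / (|t| * η * μ) = 6 / c ^ n * ε ^ δ := by
      have h2 : |t| = (ε ^ (n + 1))⁻¹ := by rw [hεd, inv_inv]
      rw [h2, hηdef, hμdef, Real.rpow_sub hε, Real.rpow_one, mul_pow]
      field_simp
      ring
    rw [h1]
    refine mul_le_mul_of_nonneg_right ?_ hεδ0.le
    calc 6 / c ^ n ≤ K' := by
          rw [hK']; exact le_add_of_nonneg_left (by positivity)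
      _ ≤ K' * A' := le_mul_of_one_le_right (by positivity) hA'1
  rw [oscInt_Icc_eq_intervalIntegral hab.le, hεδ, mul_assoc, mul_assoc, ← mul_assoc K']
  refine hpart.norm_integral_le ?_ ?_
  · have h1 : ContinuousOn (fun x => P.eval (f x)) (Icc a b) := P.continuous.comp_continuousOn hfc
    exact Complex.continuous_exp.comp_continuousOn
      (continuousOn_const.mul (Complex.continuous_ofReal.comp_continuousOn h1))
  intro u v hu huv hv hF
  rcases huv.eq_or_lt with rfl | huv
  · rw [intervalIntegral.integral_same, norm_zero]; positivity
  have hsubI : Icc u v ⊆ Icc a b := Icc_subset_Icc hu hv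
  have hsubO : Ioo u v ⊆ Ioo a b := Ioo_subset_Ioo hu hv
  have hfd : ∀ x ∈ Ioo u v, HasDerivAt f (iteratedDerivWithin 1 f (Icc a b) x) x := fun x hx => by
    simpa using hf.hasDerivAt_iteratedDerivWithin_Icc hab 0 (hsubO hx)
  have hmid : (u + v) / 2 ∈ Ioo u v := ⟨by linarith, by linarith⟩
  refine norm_integral_exp_eval_comp_le huv hη hμ ht (hfc.mono hsubI) hfd
    ((hf.continuousOn_iteratedDerivWithin_Icc hab 1).mono hsubI)
    (fun x hx => hf.hasDerivAt_iteratedDerivWithin_Icc hab 1 (hsubO hx))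
    ((hf.continuousOn_iteratedDerivWithin_Icc hab 2).mono hsubI) hF ?_ ?_ hB₃
  · intro hle
    refine (le_of_le_mul_rpow hδ (sub_pos.2 huv) hK hA0 hε ?_).trans hB₁
    refine hlen a b f hfc A hA0.le hdec u v (f ((u + v) / 2)) _ hu huv.le hv
      (mul_pos hμ (sub_pos.2 huv)) fun x hx => ?_
    have h1 := (convex_Ioo u v).norm_image_sub_le_of_norm_hasDerivWithin_le
      (fun y hy => (hfd y hy).hasDerivWithinAt) hle hmid hx
    refine h1.trans (mul_le_mul_of_nonneg_left ?_ hμ.le)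
    rw [Real.norm_eq_abs, abs_le]
    constructor <;> linarith [hx.1, hx.2]
  · intro hle
    have h1 := hlen a b f hfc A hA0.le hdec u v (f ((u + v) / 2)) (n * ε) hu huv.le hv
      (by positivity) fun x hx => abs_sub_le_of_abs_eval_comp_le
        (hfc.mono (Ioo_subset_Icc_self.trans hsubI)) hle (hpoly _ hQdeg ε hε hQ') hx hmid
    refine h1.trans (le_trans ?_ hB₂)
    rw [Real.mul_rpow hn0.le hε.le]
    calc K * A * ((n : ℝ) ^ δ * ε ^ δ) = K * (n : ℝ) ^ δ * A * ε ^ δ := by ring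
      _ ≤ _ := by gcongr

theorem theorem2p2 (d N : ℕ) (hd : 2 ≤ d) (hN : 2 ≤ N) (δ : ℝ) (hδ : δ < 1) :
    ∃ C : ℝ, 0 < C ∧
      ∀ (a b : ℝ), a ≤ b →
      ∀ f : ℝ → ℝ, ContDiffOn ℝ ∞ f (Icc a b) →
        SingleSignedOn (iteratedDerivWithin N f (Icc a b)) (Icc a b) →
      ∀ A : ℝ, 1 ≤ A →
        (∀ t : ℝ, t ≠ 0 → ‖oscInt f (Icc a b) t‖ ≤ A * |t| ^ (-δ)) →
      ∀ P : ℝ[X], P.natDegree = d →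
        ((derivative P).Monic → ∀ t : ℝ, t ≠ 0 →
          ‖oscInt (fun x => P.eval (f x)) (Icc a b) t‖
            ≤ C * A ^ (1 / (1 - δ)) * |t| ^ (-δ / (d : ℝ))) ∧
        (IsSND (derivative P) → ∀ t : ℝ, 1 ≤ |t| →
          ‖oscInt (fun x => P.eval (f x)) (Icc a b) t‖
            ≤ C * A ^ (1 / (1 - δ)) * |t| ^ (-δ / (d : ℝ))) := by
  -- One-point intervals are separated off: unique differentiability on [a, b] needs a < b.
  have hdegen : ∀ (a A t : ℝ) (φ : ℝ → ℝ), 1 ≤ A → ∀ C : ℝ, 0 < C →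
      ‖oscInt φ (Icc a a) t‖ ≤ C * A ^ (1 / (1 - δ)) * |t| ^ (-δ / (d : ℝ)) := by
    intro a A t φ hA C hC
    rw [oscInt_Icc_eq_intervalIntegral le_rfl, intervalIntegral.integral_same, norm_zero]
    have : 0 ≤ A := by linarith
    positivity
  rcases lt_or_ge δ 0 with hneg | hδ0
  · refine ⟨1, one_pos, fun a b hab f hf _ A hA hdec P _ => ?_⟩
    obtain rfl := eq_of_oscInt_decay_of_neg hab hneg hf.continuousOn (by linarith) hdec
    exact ⟨fun _ t _ => hdegen a A t _ hA 1 one_pos, fun _ t _ => hdegen a A t _ hA 1 one_pos⟩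
  obtain ⟨C, hC, hmain⟩ := exists_norm_oscInt_eval_comp_le d N hd hN δ hδ hδ0
  refine ⟨C, hC, fun a b hab f hf hs A hA hdec P hP => ?_⟩
  rcases hab.eq_or_lt with rfl | hab
  · exact ⟨fun _ t _ => hdegen a A t _ hA C hC, fun _ t _ => hdegen a A t _ hA C hC⟩
  refine ⟨fun hmon t ht => hmain a b hab f hf hs A hA hdec P hP t ht (Or.inl hmon),
    fun hsnd t ht => hmain a b hab f hf hs A hA hdec P hP t ?_ (Or.inr ⟨hsnd, ht⟩)⟩
  rintro rfl
  norm_num at ht
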